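/- A bipartite graph is a structure $(V,E,P)$ in which $E$ is an irreflexive symmetric binary relation on $V$, $P=(V_0\times V_0)\cup(V_1\times V_1)$ for some partition $V=V_0\mathbin{\dot\cup}V_1$ (a part may be empty), and $E\cap P=\emptyset$. Let $B$ be the countable universal bipartite graph, that is, the Fraïssé limit of the class of finite bipartite graphs: the (up to isomorphism unique) countable bipartite graph into which every finite bipartite graph embeds as an induced substructure and in which every isomorphism between finite induced substructures extends to an automorphism. Let $M=\operatorname{End}B$ be the monoid of all maps $B\to B$ that preserve $E$ and $P$, with maps written on the right, so that $fg$ means first $f$, then $g$. For $f,g\in M$ write $f\mathrel{\mathscr L}g$ if $Mf=Mg$, and $f\mathrel{\mathscr R}g$ if $fM=gM$; put $\mathscr H=\mathscr L\cap\mathscr R$ and $\mathscr D=\mathscr L\circ\mathscr R$. An element $f\in M$ is regular if $fgf=f$ for some $g\in M$; a $\mathscr D$-class is non-regular if it contains no regular element. For an $\mathscr H$-class $H$ of $M$ let $T_H=\{t\in M: Ht\subseteq H\}$; the Schützenberger group of $H$ is the group $\mathcal S_H=\{\gamma_t: t\in T_H\}$ under composition, where $\gamma_t\colon H\to H$, $h\mapsto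 ht$. **Theorem.** Let $\Gamma$ be any countable (undirected, loopless, simple) graph, finite or infinite. Then there are exactly $2^{\aleph_0}$ non-regular $\mathscr D$-classes $D$ of $\operatorname{End}B$ such that $\mathcal S_H\cong\operatorname{Aut}\Gamma$ for every $\mathscr H$-class $H\subseteq D$. -/

import Mathlib

open FirstOrder

universe u

/-! ### Green's relations and Schützenberger groups -/

section Monoids

variable {M : Type*} [Monoid M]

/-- Green's relation `L`: `M a = M b`. -/
def GreenL (a b : M) : Prop := Set.range (fun m : M => m * a) = Set.range (fun m : M => m * b)

/-- Green's relation `R`: `a M = b M`. -/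
def GreenR (a b : M) : Prop := Set.range (fun m : M => a * m) = Set.range (fun m : M => b * m)

/-- Green's relation `H`, the intersection of `L` and `R`. -/
def GreenH (a b : M) : Prop := GreenL a b ∧ GreenR a b

/-- Green's relation `D`, the composite of `L` and `R`. -/
def GreenD (a b : M) : Prop := Relation.Comp GreenL GreenR a b

/-- The `H`-class of `a`. -/
def HClass (a : M) : Set M := {b | GreenH a b}

/-- The `D`-class of `a`. -/
def DClass (a : M) : Set M := {b | GreenD a b}

/-- `a` is a (von Neumann) regular element: `a b a = a` for some `b`. -/
def IsRegularElement (a : M) : Prop := ∃ b : M, a * b * a = a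

/-- `T_H = {t ∈ M | H t ⊆ H}`. -/
def rightStabilizer (H : Set M) : Submonoid M where
  carrier := {t | ∀ h ∈ H, h * t ∈ H}
  one_mem' := fun h hh => by simpa using hh
  mul_mem' := fun {s t} hs ht h hh => by
    rw [← mul_assoc]
    exact ht _ (hs h hh)

/-- `t ↦ γ_t`, where `γ_t : H → H` is the map `h ↦ h t`. The maps `γ_t` are composed from left to
right, so the target is the opposite of the monoid `Function.End H`. -/
def gammaHom (H : Set M) : rightStabilizer H →* (Function.End H)ᵐᵒᵖ where
  toFun t := MulOpposite.op fun h : H => (⟨h.1 * t.1, t.2 h.1 h.2⟩ : H)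
  map_one' := by
    apply MulOpposite.unop_injective
    funext h
    exact Subtype.ext (mul_one h.1)
  map_mul' s t := by
    apply MulOpposite.unop_injective
    funext h
    exact Subtype.ext (mul_assoc h.1 s.1 t.1).symm

/-- The Schützenberger group `{γ_t | t ∈ T_H}` of an `H`-class `H`, under composition. -/
def schutzenbergerGroup (H : Set M) : Submonoid (Function.End H)ᵐᵒᵖ := MonoidHom.mrange (gammaHom H)

/-- For an `H`-class the monoid `{γ_t | t ∈ T_H}` is indeed a group. -/
theorem isUnit_of_schutzenbergerGroup (a : M) (x : schutzenbergerGroup (HClass a)) : IsUnit x := by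
  obtain ⟨x, ⟨t, rfl⟩⟩ := x
  have ht : ∀ h ∈ HClass a, h * t.1 ∈ HClass a := t.2
  set t' : M := t.1 with ht'
  have key : ∀ h ∈ HClass a, GreenL h (h * t') ∧ GreenR h (h * t') := fun h hh =>
    ⟨hh.1.symm.trans (ht h hh).1, hh.2.symm.trans (ht h hh).2⟩
  have ha : a ∈ HClass a := ⟨rfl, rfl⟩
  obtain ⟨s, hs⟩ : a ∈ Set.range (fun m : M => a * t' * m) := by
    rw [← (key a ha).2]
    exact ⟨1, mul_one a⟩
  dsimp only at hs
  have hts : ∀ h ∈ HClass a, h * t' * s = h := by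
    intro h hh
    obtain ⟨k, rfl⟩ : h ∈ Set.range (fun m : M => m * a) := by
      rw [hh.1]
      exact ⟨1, one_mul h⟩
    dsimp only
    rw [mul_assoc k a t', mul_assoc k (a * t') s, hs]
  have hst : ∀ h ∈ HClass a, h * s * t' = h := by
    intro h hh
    obtain ⟨m, hm⟩ : h ∈ Set.range (fun m : M => m * (h * t')) := by
      rw [← (key h hh).1]
      exact ⟨1, one_mul h⟩
    dsimp only at hm
    calc h * s * t' = m * (h * t') * s * t' := by rw [hm]
      _ = m * (h * t' * s) * t := by rw [mul_assoc m (h * t') s]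
      _ = m * (h * t') := by rw [hts h hh, mul_assoc]
      _ = h := hm
  have hsT : s ∈ rightStabilizer (HClass a) := by
    intro h hh
    obtain ⟨m, hm⟩ : h ∈ Set.range (fun m : M => m * (h * t')) := by
      rw [← (key h hh).1]
      exact ⟨1, one_mul h⟩
    obtain ⟨n, hn⟩ : h * t' ∈ Set.range (fun m : M => m * h) := by
      rw [(key h hh).1]
      exact ⟨1, one_mul _⟩
    dsimp only at hm hn
    have e1 : h * s = m * h := by
      calc h * s = m * (h * t') * s := by rw [hm]
        _ = m * h := by rw [mul_assoc, hts h hh]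
    have e2 : h = n * (h * s) := by
      rw [← mul_assoc, hn, hts h hh]
    refine ⟨hh.1.trans ?_, hh.2.trans ?_⟩
    · apply Set.Subset.antisymm
      · rintro _ ⟨y, rfl⟩
        exact ⟨y * n, by dsimp only; rw [mul_assoc, ← e2]⟩
      · rintro _ ⟨y, rfl⟩
        exact ⟨y * m, by dsimp only; rw [mul_assoc, ← e1]⟩
    · apply Set.Subset.antisymm
      · rintro _ ⟨y, rfl⟩
        exact ⟨t' * y, by dsimp only; rw [← mul_assoc, hst h hh]⟩
      · rintro _ ⟨y, rfl⟩
        exact ⟨s * y, by dsimp only; rw [← mul_assoc]⟩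
  have h1 : gammaHom (HClass a) t * gammaHom (HClass a) ⟨s, hsT⟩ = 1 := by
    apply MulOpposite.unop_injective
    funext h
    exact Subtype.ext (hts h.1 h.2)
  have h2 : gammaHom (HClass a) ⟨s, hsT⟩ * gammaHom (HClass a) t = 1 := by
    apply MulOpposite.unop_injective
    funext h
    exact Subtype.ext (hst h.1 h.2)
  exact ⟨⟨⟨gammaHom (HClass a) t, ⟨t, rfl⟩⟩, ⟨gammaHom (HClass a) ⟨s, hsT⟩, ⟨⟨s, hsT⟩, rfl⟩⟩,
    Subtype.ext h1, Subtype.ext h2⟩, rfl⟩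

end Monoids

/-! ### Endomorphism monoids of first-order structures -/

/-- The endomorphisms of a structure. As maps act on the right, `f * g` is `f` followed by `g`. -/
def StructureEnd (L : Language) (A : Type*) [L.Structure A] : Type _ := A →[L] A

instance StructureEnd.instMonoid (L : Language) (A : Type*) [L.Structure A] : Monoid (StructureEnd L A) where
  mul f g := Language.Hom.comp g f
  one := Language.Hom.id L A
  mul_assoc _ _ _ := rfl
  one_mul _ := rfl
  mul_one _ := rfl

/-! ### Bipartite graphs -/

/-- The two binary relation symbols of bipartite graphs `(V, E, P)`. -/
inductive BipartiteRel : ℕ → Type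
  | adj : BipartiteRel 2
  | part : BipartiteRel 2

/-- The signature of bipartite graphs `(V, E, P)`. -/
def bipartiteLanguage : Language := ⟨fun _ => Empty, BipartiteRel⟩

instance bipartiteLanguage.instIsRelational : bipartiteLanguage.IsRelational := fun _ => inferInstanceAs (IsEmpty Empty)

/-- The edge relation `E`. -/
def bipAdj {V : Type*} [bipartiteLanguage.Structure V] (u v : V) : Prop :=
  Language.Structure.RelMap (L := bipartiteLanguage) BipartiteRel.adj ![u, v]

/-- The relation `P` of lying in the same part. -/
def bipPart {V : Type*} [bipartiteLanguage.Structure V] (u v : V) : Prop :=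
  Language.Structure.RelMap (L := bipartiteLanguage) BipartiteRel.part ![u, v]

/-- `(V, E, P)` is a bipartite graph: `E` is irreflexive and symmetric,
`P = (V₀ × V₀) ∪ (V₁ × V₁)` for some partition of `V` into a set `V₀` and its complement `V₁`
(one of which may be empty), and `E` is disjoint from `P`. -/
structure IsBipartiteGraph (V : Type*) [bipartiteLanguage.Structure V] : Prop where
  irrefl : ∀ v : V, ¬ bipAdj v v
  symm : ∀ u v : V, bipAdj u v → bipAdj v u
  partition : ∃ V₀ : Set V, ∀ u v : V, bipPart u v ↔ (u ∈ V₀ ∧ v ∈ V₀) ∨ (u ∈ V₀ᶜ ∧ v ∈ V₀ᶜ)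
  not_part : ∀ u v : V, bipAdj u v → ¬ bipPart u v

/-- The class of finite bipartite graphs. Following the convention for ages, it contains the
empty structure. -/
def finiteBipartiteGraphs : Set (CategoryTheory.Bundled.{u} bipartiteLanguage.Structure) :=
  {V | Finite V ∧ IsBipartiteGraph V}

/-- `B` is (a copy of) the countable universal bipartite graph, the Fraïssé limit of the finite
bipartite graphs. -/
def IsCountableUniversalBipartiteGraph (B : Type*) [Countable B] [bipartiteLanguage.Structure B] :
    Prop :=
  Language.IsFraisseLimit finiteBipartiteGraphs B

/-! ### Green's relations and the invariance of the Schützenberger group on a 𝓓-class. -/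

section GreenRelations

variable {M : Type*} [Monoid M]

theorem greenL_iff {a b : M} : GreenL a b ↔ ∃ m n, b = m * a ∧ a = n * b := by
  constructor
  · intro h
    obtain ⟨n, hn⟩ : a ∈ Set.range (fun m : M => m * b) := h ▸ ⟨1, one_mul a⟩
    obtain ⟨m, hm⟩ : b ∈ Set.range (fun m : M => m * a) := by rw [h]; exact ⟨1, one_mul b⟩
    exact ⟨m, n, hm.symm, hn.symm⟩
  · rintro ⟨m, n, hb, ha⟩
    apply Set.Subset.antisymm
    · rintro _ ⟨y, rfl⟩
      exact ⟨y * n, by dsimp only; rw [mul_assoc, ← ha]⟩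
    · rintro _ ⟨y, rfl⟩
      exact ⟨y * m, by dsimp only; rw [mul_assoc, ← hb]⟩

theorem greenR_iff {a b : M} : GreenR a b ↔ ∃ m n, b = a * m ∧ a = b * n := by
  constructor
  · intro h
    obtain ⟨n, hn⟩ : a ∈ Set.range (fun m : M => b * m) := h ▸ ⟨1, mul_one a⟩
    obtain ⟨m, hm⟩ : b ∈ Set.range (fun m : M => a * m) := by rw [h]; exact ⟨1, mul_one b⟩
    exact ⟨m, n, hm.symm, hn.symm⟩
  · rintro ⟨m, n, hb, ha⟩
    apply Set.Subset.antisymm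
    · rintro _ ⟨y, rfl⟩
      exact ⟨n * y, by dsimp only; rw [← mul_assoc, ← ha]⟩
    · rintro _ ⟨y, rfl⟩
      exact ⟨m * y, by dsimp only; rw [← mul_assoc, ← hb]⟩

theorem GreenL.mul_right {a b : M} (h : GreenL a b) (t : M) : GreenL (a * t) (b * t) := by
  obtain ⟨m, n, hb, ha⟩ := greenL_iff.1 h
  exact greenL_iff.2 ⟨m, n, by rw [← mul_assoc, ← hb], by rw [← mul_assoc, ← ha]⟩

theorem GreenR.mul_left {a b : M} (h : GreenR a b) (t : M) : GreenR (t * a) (t * b) := by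
  obtain ⟨m, n, hb, ha⟩ := greenR_iff.1 h
  exact greenR_iff.2 ⟨m, n, by rw [mul_assoc, ← hb], by rw [mul_assoc, ← ha]⟩

theorem greenD_refl (a : M) : GreenD a a := ⟨a, rfl, rfl⟩

theorem IsRegularElement.of_greenD {a b : M} (h : GreenD a b) (hb : IsRegularElement b) :
    IsRegularElement a := by
  obtain ⟨c, hL, hR⟩ := h
  obtain ⟨m, n, hc, ha⟩ := greenL_iff.1 hL
  obtain ⟨p, q, hb', hc'⟩ := greenR_iff.1 hR
  obtain ⟨y, hy⟩ := hb
  have h1 : c * (p * y) * c = c := by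
    calc c * (p * y) * c = c * p * y * (b * q) := by rw [← hc', mul_assoc c p y]
      _ = b * y * b * q := by rw [← hb', ← mul_assoc]
      _ = c := by rw [hy, ← hc']
  refine ⟨p * y * m, ?_⟩
  calc a * (p * y * m) * a = n * (c * (p * y) * (m * a)) := by
        nth_rw 1 [ha]; simp only [mul_assoc]
    _ = a := by rw [← hc, h1, ← ha]

/-- One element tests the whole 𝓗-class: any other is `m * a`, 𝓛 is a right congruence and 𝓡 a left
congruence. -/
theorem mem_rightStabilizer_iff {a t : M} :
    t ∈ rightStabilizer (HClass a) ↔ GreenH a (a * t) := by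
  constructor
  · intro h
    exact h a ⟨rfl, rfl⟩
  · rintro ⟨hL, hR⟩ h ⟨hL', hR'⟩
    refine ⟨hL.trans (hL'.mul_right t), hR'.trans ?_⟩
    obtain ⟨m, n, hh, -⟩ := greenL_iff.1 hL'
    rw [hh, mul_assoc]
    exact hR.mul_left m

theorem gammaHom_eq_iff {a : M} (s t : rightStabilizer (HClass a)) :
    gammaHom (HClass a) s = gammaHom (HClass a) t ↔ a * s.1 = a * t.1 := by
  constructor
  · intro h
    exact congrArg Subtype.val (congrFun (MulOpposite.op_injective h) ⟨a, rfl, rfl⟩)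
  · intro h
    apply MulOpposite.unop_injective
    funext x
    obtain ⟨m, n, hx, -⟩ := greenL_iff.1 x.2.1
    refine Subtype.ext ?_
    change x.1 * s.1 = x.1 * t.1
    rw [hx, mul_assoc, h, mul_assoc]

/-- A multiplicative correspondence between the sources of two monoid homomorphisms that matches
their kernels induces an isomorphism of their ranges. -/
theorem nonempty_mulEquiv_mrange_of_correspondence {S T N N' : Type*} [Monoid S] [Monoid T]
    [Monoid N] [Monoid N'] (f : S →* N) (g : T →* N') (r : S → T → Prop)
    (hl : ∀ s, ∃ t, r s t) (hr : ∀ t, ∃ s, r s t)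
    (hmul : ∀ s s' t t', r s t → r s' t' → r (s * s') (t * t'))
    (hker : ∀ s s' t t', r s t → r s' t' → (f s = f s' ↔ g t = g t')) :
    Nonempty (MonoidHom.mrange f ≃* MonoidHom.mrange g) := by
  choose F hF using fun x : MonoidHom.mrange f => x.2
  choose φ hφ using hl
  let e : MonoidHom.mrange f → MonoidHom.mrange g := fun x => ⟨g (φ (F x)), _, rfl⟩
  refine ⟨MulEquiv.mk (Equiv.ofBijective e ⟨?_, ?_⟩) ?_⟩
  · intro x y hxy
    have := (hker _ _ _ _ (hφ (F x)) (hφ (F y))).2 (congrArg Subtype.val hxy)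
    rw [hF, hF] at this
    exact Subtype.ext this
  · rintro ⟨_, t, rfl⟩
    obtain ⟨s, hs⟩ := hr t
    refine ⟨⟨f s, s, rfl⟩, Subtype.ext ?_⟩
    exact (hker _ _ _ _ (hφ _) hs).1 (hF _)
  · intro x y
    refine Subtype.ext ?_
    change g (φ (F (x * y))) = g (φ (F x)) * g (φ (F y))
    rw [← map_mul]
    refine (hker _ _ _ _ (hφ _) (hmul _ _ _ _ (hφ _) (hφ _))).1 ?_
    rw [hF, map_mul, hF, hF]
    rfl

/-- Left multiplication carries one 𝓗-class to the other and commutes with right multiplication, so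
both have the same stabilizer, acting with the same kernel. -/
theorem GreenL.nonempty_schutzenbergerGroup_mulEquiv {a b : M} (h : GreenL a b) :
    Nonempty (schutzenbergerGroup (HClass a) ≃* schutzenbergerGroup (HClass b)) := by
  have key : ∀ a b : M, GreenL a b → ∀ t ∈ rightStabilizer (HClass a),
      t ∈ rightStabilizer (HClass b) := by
    intro a b h t ht
    rw [mem_rightStabilizer_iff] at ht ⊢
    refine ⟨h.symm.trans (ht.1.trans (h.mul_right t)), ?_⟩
    obtain ⟨m, n, hb, -⟩ := greenL_iff.1 h
    rw [hb, mul_assoc]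
    exact ht.2.mul_left m
  refine nonempty_mulEquiv_mrange_of_correspondence _ _ (fun s t => s.1 = t.1)
    (fun s => ⟨⟨s.1, key a b h _ s.2⟩, rfl⟩) (fun t => ⟨⟨t.1, key b a h.symm _ t.2⟩, rfl⟩)
    (fun s s' t t' h h' => congrArg₂ (· * ·) h h') ?_
  intro s s' t t' hs hs'
  obtain ⟨m, n, hb, ha⟩ := greenL_iff.1 h
  rw [gammaHom_eq_iff, gammaHom_eq_iff, ← hs, ← hs']
  constructor
  · intro e
    calc b * s.1 = m * (a * s.1) := by rw [← mul_assoc, ← hb]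
      _ = b * s'.1 := by rw [e, ← mul_assoc, ← hb]
  · intro e
    calc a * s.1 = n * (b * s.1) := by rw [← mul_assoc, ← ha]
      _ = a * s'.1 := by rw [e, ← mul_assoc, ← ha]

/-- With `b = a * p` and `a = b * q`, the action of `t` on the class of `a` is transported to that
of `q * t * p`. Right multiplication by `p * q` fixes `a * t`, since that element lies in `M a`. -/
theorem GreenR.nonempty_schutzenbergerGroup_mulEquiv {a b : M} (h : GreenR a b) :
    Nonempty (schutzenbergerGroup (HClass a) ≃* schutzenbergerGroup (HClass b)) := by
  obtain ⟨p, q, hb, ha⟩ := greenR_iff.1 h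
  have key : ∀ {a b p q t : M}, b = a * p → a = b * q → t ∈ rightStabilizer (HClass a) →
      a * t * p * q = a * t := by
    intro a b p q t hb ha ht
    obtain ⟨m, n, hm, -⟩ := greenL_iff.1 (mem_rightStabilizer_iff.1 ht).1
    rw [hm, mul_assoc, mul_assoc m, ← mul_assoc a, ← hb, ← ha]
  have mem : ∀ {a b p q t : M}, b = a * p → a = b * q → t ∈ rightStabilizer (HClass a) →
      q * t * p ∈ rightStabilizer (HClass b) := by
    intro a b p q t hb ha ht
    have ht' := mem_rightStabilizer_iff.1 ht
    have e : b * (q * t * p) = a * t * p := by rw [← mul_assoc, ← mul_assoc, ← ha]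
    rw [mem_rightStabilizer_iff, e]
    refine ⟨hb ▸ ht'.1.mul_right p, ?_⟩
    exact (greenR_iff.2 ⟨q, p, ha, hb⟩ : GreenR b a).trans
      (ht'.2.trans (greenR_iff.2 ⟨p, q, rfl, (key hb ha ht).symm⟩))
  refine nonempty_mulEquiv_mrange_of_correspondence _ _ (fun s t => a * s.1 * p = b * t.1)
    (fun s => ⟨⟨_, mem hb ha s.2⟩, ?_⟩) (fun t => ⟨⟨_, mem ha hb t.2⟩, ?_⟩) ?_ ?_
  · change _ = b * (q * s.1 * p)
    rw [← mul_assoc, ← mul_assoc, ← ha]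
  · change a * (p * t.1 * q) * p = _
    rw [← mul_assoc, ← mul_assoc, ← hb]
    exact key ha hb t.2
  · intro s s' t t' e e'
    obtain ⟨m, n, hm, -⟩ := greenL_iff.1 (mem_rightStabilizer_iff.1 s.2).1
    have hbt : b * t.1 = m * b := by rw [← e, hm, mul_assoc, ← hb]
    change a * (s.1 * s'.1) * p = b * (t.1 * t'.1)
    rw [← mul_assoc, hm, ← mul_assoc b, hbt, mul_assoc m b, ← e']
    simp only [mul_assoc]
  · intro s s' t t' e e'
    rw [gammaHom_eq_iff, gammaHom_eq_iff, ← e, ← e']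
    constructor
    · intro h
      rw [h]
    · intro h
      rw [← key hb ha s.2, h, key hb ha s'.2]

theorem GreenD.nonempty_schutzenbergerGroup_mulEquiv {a b : M} (h : GreenD a b) :
    Nonempty (schutzenbergerGroup (HClass a) ≃* schutzenbergerGroup (HClass b)) := by
  obtain ⟨c, hL, hR⟩ := h
  obtain ⟨e⟩ := hL.nonempty_schutzenbergerGroup_mulEquiv
  obtain ⟨e'⟩ := hR.nonempty_schutzenbergerGroup_mulEquiv
  exact ⟨e.trans e'⟩

end GreenRelations

/-! ### Generic sided graphs and back-and-forth. -/

/-- A bipartite graph with a chosen ordered bipartition. -/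
structure SidedGraph (V : Type*) where
  /-- The part containing a vertex. -/
  side : V → Bool
  /-- The edge relation. -/
  Adj : V → V → Prop
  symm : ∀ u v, Adj u v → Adj v u
  side_ne : ∀ u v, Adj u v → side u ≠ side v

namespace SidedGraph

/-- The extension property: over any finite set there are new vertices in either part with
prescribed neighbours. -/
def Generic {V : Type*} (G : SidedGraph V) : Prop :=
  ∀ (s : Bool) (X : Finset V) (p : V → Prop),
    ∃ y, y ∉ X ∧ G.side y = s ∧ ∀ x ∈ X, G.side x ≠ s → (G.Adj x y ↔ p x)

variable {V V' : Type*} (G : SidedGraph V) (G' : SidedGraph V')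

theorem adj_comm {u v : V} : G.Adj u v ↔ G.Adj v u := ⟨G.symm u v, G.symm v u⟩

/-- Finite partial isomorphisms, as finite sets of pairs. -/
def FinitePartialIso : Type _ :=
  {f : Finset (V × V') // ∀ p ∈ f, G.side p.1 = G'.side p.2 ∧
    ∀ q ∈ f, (p.1 = q.1 ↔ p.2 = q.2) ∧ (G.Adj p.1 q.1 ↔ G'.Adj p.2 q.2)}

namespace FinitePartialIso

instance : PartialOrder (FinitePartialIso G G') := Subtype.partialOrder _

instance : Inhabited (FinitePartialIso G G') := ⟨⟨∅, by simp⟩⟩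

variable {G G'}

/-- The inverse partial isomorphism. -/
noncomputable def symm (f : FinitePartialIso G G') : FinitePartialIso G' G := by
  classical
  exact ⟨f.1.image Prod.swap, by
    intro p hp
    obtain ⟨p, hp', rfl⟩ := Finset.mem_image.1 hp
    refine ⟨(f.2 p hp').1.symm, fun q hq => ?_⟩
    obtain ⟨q, hq', rfl⟩ := Finset.mem_image.1 hq
    exact ⟨((f.2 p hp').2 q hq').1.symm, ((f.2 p hp').2 q hq').2.symm⟩⟩

theorem mem_symm {f : FinitePartialIso G G'} {p : V' × V} : p ∈ f.symm.1 ↔ p.swap ∈ f.1 := by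
  classical
  simp only [symm, Finset.mem_image]
  constructor
  · rintro ⟨q, hq, rfl⟩
    simpa using hq
  · intro h
    exact ⟨p.swap, h, by simp⟩

theorem exists_extension (h : G'.Generic) (f : FinitePartialIso G G') (a : V) :
    ∃ g : FinitePartialIso G G', f ≤ g ∧ ∃ b, (a, b) ∈ g.1 := by
  classical
  by_cases ha : ∃ b, (a, b) ∈ f.1
  · exact ⟨f, le_rfl, ha⟩
  push Not at ha
  -- The new image copies the adjacencies of `a`, transported along `f`; injectivity of `f` makes
  -- the prescription consistent.
  obtain ⟨b, hb, hs, hadj⟩ := h (G.side a) (f.1.image Prod.snd)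
    (fun y => ∃ x, (x, y) ∈ f.1 ∧ G.Adj x a)
  have hne : ∀ p ∈ f.1, p.1 ≠ a ∧ p.2 ≠ b := by
    intro p hp
    refine ⟨?_, ?_⟩
    · rintro rfl
      exact ha p.2 hp
    · rintro rfl
      exact hb (Finset.mem_image_of_mem _ hp)
  have hadj' : ∀ p ∈ f.1, (G.Adj p.1 a ↔ G'.Adj p.2 b) := by
    intro p hp
    by_cases hps : G.side p.1 = G.side a
    · refine iff_of_false (fun h => G.side_ne _ _ h hps) (fun h => G'.side_ne _ _ h ?_)
      rw [hs, ← hps, (f.2 p hp).1]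
    · rw [hadj p.2 (Finset.mem_image_of_mem _ hp) (by rw [← (f.2 p hp).1]; exact hps)]
      constructor
      · intro h
        exact ⟨p.1, hp, h⟩
      · rintro ⟨x, hx, h⟩
        rwa [(((f.2 p hp).2 _ hx).1.2 rfl)]
  refine ⟨⟨insert (a, b) f.1, ?_⟩, Finset.subset_insert _ _, b, Finset.mem_insert_self _ _⟩
  intro p hp
  rcases Finset.mem_insert.1 hp with rfl | hp
  · refine ⟨hs.symm, fun q hq => ?_⟩
    rcases Finset.mem_insert.1 hq with rfl | hq
    · exact ⟨by simp, iff_of_false (fun h => G.side_ne _ _ h rfl) (fun h => G'.side_ne _ _ h rfl)⟩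
    · refine ⟨iff_of_false (hne q hq).1.symm (hne q hq).2.symm, ?_⟩
      rw [G.adj_comm, G'.adj_comm]
      exact hadj' q hq
  · refine ⟨(f.2 p hp).1, fun q hq => ?_⟩
    rcases Finset.mem_insert.1 hq with rfl | hq
    · exact ⟨iff_of_false (hne p hp).1 (hne p hp).2, hadj' p hp⟩
    · exact (f.2 p hp).2 q hq

/-- The partial isomorphisms defined at `a`. -/
def definedAtLeft (h : G'.Generic) (a : V) : Order.Cofinal (FinitePartialIso G G') where
  carrier := {f | ∃ b, (a, b) ∈ f.1}
  isCofinal f := by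
    obtain ⟨g, hg, hb⟩ := f.exists_extension h a
    exact ⟨g, hb, hg⟩

/-- The partial isomorphisms whose inverse is defined at `b`. -/
def definedAtRight (h : G.Generic) (b : V') : Order.Cofinal (FinitePartialIso G G') where
  carrier := {f | ∃ a, (a, b) ∈ f.1}
  isCofinal f := by
    obtain ⟨g, hg, a, ha⟩ := f.symm.exists_extension h b
    refine ⟨g.symm, ⟨a, mem_symm.2 ha⟩, ?_⟩
    intro p hp
    exact mem_symm.2 (hg (mem_symm.2 (by simpa using hp)))

end FinitePartialIso

/-- Any two countable generic bipartite graphs are isomorphic. -/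
theorem Generic.exists_equiv {G : SidedGraph V} {G' : SidedGraph V'} [Countable V] [Countable V']
    (h : G.Generic) (h' : G'.Generic) :
    ∃ e : V ≃ V', (∀ v, G'.side (e v) = G.side v) ∧ ∀ u v, G'.Adj (e u) (e v) ↔ G.Adj u v := by
  classical
  have := Encodable.ofCountable V
  have := Encodable.ofCountable V'
  let cofinals : V ⊕ V' → Order.Cofinal (FinitePartialIso G G') := fun x =>
    Sum.recOn x (FinitePartialIso.definedAtLeft h') (FinitePartialIso.definedAtRight h)
  let I : Order.Ideal (FinitePartialIso G G') := Order.idealOfCofinals default cofinals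
  have hl : ∀ a, ∃ b, ∃ f ∈ I, (a, b) ∈ f.1 := fun a => by
    obtain ⟨f, ⟨b, hb⟩, hf⟩ := Order.cofinal_meets_idealOfCofinals default cofinals (Sum.inl a)
    exact ⟨b, f, hf, hb⟩
  have hr : ∀ b, ∃ a, ∃ f ∈ I, (a, b) ∈ f.1 := fun b => by
    obtain ⟨f, ⟨a, ha⟩, hf⟩ := Order.cofinal_meets_idealOfCofinals default cofinals (Sum.inr b)
    exact ⟨a, f, hf, ha⟩
  choose F hF using hl
  choose F' hF' using hr
  have key : ∀ p q : V × V', (∃ f ∈ I, p ∈ f.1) → (∃ f ∈ I, q ∈ f.1) →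
      G.side p.1 = G'.side p.2 ∧ (p.1 = q.1 ↔ p.2 = q.2) ∧ (G.Adj p.1 q.1 ↔ G'.Adj p.2 q.2) := by
    rintro p q ⟨f, hf, hp⟩ ⟨g, hg, hq⟩
    obtain ⟨k, -, hfk, hgk⟩ := I.directed _ hf _ hg
    exact ⟨(k.2 p (hfk hp)).1, (k.2 p (hfk hp)).2 q (hgk hq)⟩
  refine ⟨⟨F, F', fun a => ?_, fun b => ?_⟩, fun v => ?_, fun u v => ?_⟩
  · exact (key _ _ (hF' (F a)) (hF a)).2.1.2 rfl
  · exact (key _ _ (hF (F' b)) (hF' b)).2.1.1 rfl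
  · exact (key _ _ (hF v) (hF v)).1.symm
  · exact (key _ _ (hF u) (hF v)).2.2.symm

end SidedGraph

/-! ### Translation between sided graphs and relational structures. -/

section BipartiteLanguage

/-- The structure with given relations `E` and `P`. -/
@[reducible] def bipartiteStructure {V : Type*} (adj part : V → V → Prop) :
    bipartiteLanguage.Structure V where
  funMap := fun f => f.elim
  RelMap := fun r x => match r with
    | .adj => adj (x 0) (x 1)
    | .part => part (x 0) (x 1)

/-- The relational structure of a bipartite graph with a chosen bipartition. -/
@[reducible] def SidedGraph.toStructure {V : Type*} (G : SidedGraph V) :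
    bipartiteLanguage.Structure V :=
  bipartiteStructure G.Adj (fun u v => G.side u = G.side v)

theorem SidedGraph.isBipartiteGraph_toStructure {V : Type*} (G : SidedGraph V) :
    @IsBipartiteGraph V G.toStructure := by
  let := G.toStructure
  refine ⟨fun v h => G.side_ne v v h rfl, fun u v h => G.symm u v h,
    ⟨{v | G.side v = true}, fun u v => ?_⟩, fun u v h => G.side_ne u v h⟩
  change G.side u = G.side v ↔ _
  simp only [Set.mem_ofPred_eq, Set.mem_compl_iff]
  cases G.side u <;> cases G.side v <;> simp

variable {V V' : Type*} [bipartiteLanguage.Structure V] [bipartiteLanguage.Structure V']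

theorem relMap_adj_iff (x : Fin 2 → V) :
    Language.Structure.RelMap (L := bipartiteLanguage) BipartiteRel.adj x ↔
      bipAdj (x 0) (x 1) := by
  have : x = ![x 0, x 1] := by
    ext i
    fin_cases i <;> rfl
  rw [bipAdj, ← this]

theorem relMap_part_iff (x : Fin 2 → V) :
    Language.Structure.RelMap (L := bipartiteLanguage) BipartiteRel.part x ↔
      bipPart (x 0) (x 1) := by
  have : x = ![x 0, x 1] := by
    ext i
    fin_cases i <;> rfl
  rw [bipPart, ← this]

theorem bipAdj_embedding (e : V ↪[bipartiteLanguage] V') (u v : V) :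
    bipAdj (e u) (e v) ↔ bipAdj u v := (relMap_adj_iff _).symm.trans (e.map_rel BipartiteRel.adj ![u, v])

theorem bipPart_embedding (e : V ↪[bipartiteLanguage] V') (u v : V) :
    bipPart (e u) (e v) ↔ bipPart u v := (relMap_part_iff _).symm.trans (e.map_rel BipartiteRel.part ![u, v])

theorem bipAdj_hom (e : V →[bipartiteLanguage] V') {u v : V} (h : bipAdj u v) :
    bipAdj (e u) (e v) := (relMap_adj_iff _).1 (e.map_rel _ _ h)

/-- A homomorphism from a map that preserves `E` and `P`. -/
def bipHom (f : V → V') (hadj : ∀ u v, bipAdj u v → bipAdj (f u) (f v))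
    (hpart : ∀ u v, bipPart u v → bipPart (f u) (f v)) : V →[bipartiteLanguage] V' where
  toFun := f
  map_fun' := fun g => g.elim
  map_rel' := fun {n} (r : BipartiteRel n) x => match n, r, x with
    | _, .adj, x => fun h => (relMap_adj_iff _).2 (hadj _ _ ((relMap_adj_iff x).1 h))
    | _, .part, x => fun h => (relMap_part_iff _).2 (hpart _ _ ((relMap_part_iff x).1 h))

/-- An embedding from an injective map that preserves and reflects `E` and `P`. -/
def bipEmbedding (f : V ↪ V') (hadj : ∀ u v, bipAdj (f u) (f v) ↔ bipAdj u v)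
    (hpart : ∀ u v, bipPart (f u) (f v) ↔ bipPart u v) : V ↪[bipartiteLanguage] V' where
  toFun := f
  inj' := f.injective
  map_fun' := fun g => g.elim
  map_rel' := fun {n} (r : BipartiteRel n) x => match n, r, x with
    | _, .adj, x => (relMap_adj_iff _).trans ((hadj _ _).trans (relMap_adj_iff x).symm)
    | _, .part, x => (relMap_part_iff _).trans ((hpart _ _).trans (relMap_part_iff x).symm)

end BipartiteLanguage

/-- The sided graph `G` describes the bipartite graph structure on `B`. -/
structure SidedGraph.Describes {B : Type*} [bipartiteLanguage.Structure B] (G : SidedGraph B) :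
    Prop where
  adj : ∀ u v : B, bipAdj u v ↔ G.Adj u v
  part : ∀ u v : B, bipPart u v ↔ G.side u = G.side v

/-! ### The Fraïssé limit as a generic sided graph. -/

section Fraisse

variable {B : Type u} [Countable B] [bipartiteLanguage.Structure B]

theorem IsCountableUniversalBipartiteGraph.isBipartiteGraph_closure
    (hB : IsCountableUniversalBipartiteGraph B) {S : Set B} (hS : S.Finite) :
    IsBipartiteGraph (Language.Substructure.closure bipartiteLanguage S) := by
  have h := Language.age.fg_substructure (Language.Substructure.fg_closure (L := bipartiteLanguage) hS)
  rw [hB.age] at h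
  exact h.2

theorem IsCountableUniversalBipartiteGraph.nonempty_embedding
    (hB : IsCountableUniversalBipartiteGraph B) {V : Type u} [Finite V] (G : SidedGraph V) :
    letI := G.toStructure
    Nonempty (V ↪[bipartiteLanguage] B) := by
  let := G.toStructure
  have h : (⟨V, G.toStructure⟩ : CategoryTheory.Bundled bipartiteLanguage.Structure) ∈ bipartiteLanguage.age B := by
    rw [hB.age]
    exact ⟨‹Finite V›, G.isBipartiteGraph_toStructure⟩
  exact h.2

theorem IsCountableUniversalBipartiteGraph.exists_describes
    (hB : IsCountableUniversalBipartiteGraph B) : ∃ G : SidedGraph B, G.Describes := by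
  classical
  obtain ⟨a⟩ : Nonempty B := by
    let G : SidedGraph (ULift.{u} Bool) :=
      ⟨fun b => b.down, fun b c => b.down ≠ c.down, fun _ _ => Ne.symm, fun _ _ h => h⟩
    let := G.toStructure
    obtain ⟨e⟩ := hB.nonempty_embedding G
    exact ⟨e ⟨true⟩⟩
  -- The axioms are checked inside the finite substructure on three points; the base point `a` fixes
  -- the bipartition globally.
  have key : ∀ u v : B, (bipAdj u v → bipAdj v u) ∧ (bipAdj u v → ¬ bipPart u v) ∧
      (bipPart u v ↔ (bipPart a u ↔ bipPart a v)) := by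
    intro u v
    have hS : ({a, u, v} : Set B).Finite := by simp
    have h := hB.isBipartiteGraph_closure hS
    set C := Language.Substructure.closure bipartiteLanguage ({a, u, v} : Set B)
    have hsub : ({a, u, v} : Set B) ⊆ C := Language.Substructure.subset_closure
    let a' : C := ⟨a, hsub (by simp)⟩
    let u' : C := ⟨u, hsub (by simp)⟩
    let v' : C := ⟨v, hsub (by simp)⟩
    have hadj := bipAdj_embedding C.subtype
    have hpart := bipPart_embedding C.subtype
    obtain ⟨V₀, hV⟩ := h.partition
    refine ⟨fun h1 => (hadj v' u').2 (h.symm _ _ ((hadj u' v').1 h1)),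
      fun h1 h2 => h.not_part _ _ ((hadj u' v').1 h1) ((hpart u' v').1 h2), ?_⟩
    change bipPart (C.subtype u') (C.subtype v') ↔
      (bipPart (C.subtype a') (C.subtype u') ↔ bipPart (C.subtype a') (C.subtype v'))
    rw [hpart, hpart, hpart, hV, hV, hV]
    simp only [Set.mem_compl_iff]
    tauto
  refine ⟨⟨fun v => decide (bipPart a v), bipAdj, fun u v => (key u v).1, fun u v h => ?_⟩,
    fun u v => Iff.rfl, fun u v => ?_⟩
  · have h1 := (key u v).2.1 h
    rw [(key u v).2.2] at h1
    simpa using h1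
  · rw [(key u v).2.2]
    simp

/-- The subgraph induced on a set of vertices, as a structure. -/
def SidedGraph.restrict {V : Type*} (G : SidedGraph V) (X : Set V) : SidedGraph X where
  side x := G.side x
  Adj x y := G.Adj x y
  symm x y := G.symm x y
  side_ne x y := G.side_ne x y

/-- The graph with a vertex added in the part `s`, joined to the vertices of the other part which
satisfy `p`. -/
def SidedGraph.addVertex {V : Type*} (G : SidedGraph V) (s : Bool) (p : V → Prop) :
    SidedGraph (Option V) where
  side x := x.elim s G.side
  Adj
    | some x, some y => G.Adj x y
    | some x, none => G.side x ≠ s ∧ p x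
    | none, some x => G.side x ≠ s ∧ p x
    | none, none => False
  symm
    | some x, some y => G.symm x y
    | some _, none => id
    | none, some _ => id
    | none, none => id
  side_ne
    | some x, some y => G.side_ne x y
    | some _, none => And.left
    | none, some _ => fun h => h.1.symm
    | none, none => False.elim

theorem SidedGraph.Describes.generic {G : SidedGraph B} (hG : G.Describes)
    (hB : IsCountableUniversalBipartiteGraph B) : G.Generic := by
  classical
  have hside : ∀ s, ∃ b, G.side b = s := by
    let K : SidedGraph (ULift.{u} Bool) :=
      ⟨fun b => b.down, fun b c => b.down ≠ c.down, fun _ _ => Ne.symm, fun _ _ h => h⟩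
    let := K.toStructure
    obtain ⟨e⟩ := hB.nonempty_embedding K
    have h : G.side (e ⟨true⟩) ≠ G.side (e ⟨false⟩) := by
      refine G.side_ne _ _ ((hG.adj _ _).1 ((bipAdj_embedding e _ _).2 ?_))
      change true ≠ false
      simp
    intro s
    by_cases hs : G.side (e ⟨true⟩) = s
    · exact ⟨_, hs⟩
    · refine ⟨e ⟨false⟩, ?_⟩
      cases h1 : G.side (e ⟨true⟩) <;> cases h2 : G.side (e ⟨false⟩) <;> cases s <;> simp_all
  intro s X p
  -- `P` determines sides only relative to other vertices; including `b` among the old vertices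
  -- forces the new one into part `s`.
  obtain ⟨b, hb⟩ := hside s
  let Y : Set B := ↑(insert b X)
  let := (G.restrict Y).toStructure
  let T := (G.restrict Y).addVertex s (fun x => p x)
  let := T.toStructure
  let f : Y ↪[bipartiteLanguage] B := bipEmbedding (Function.Embedding.subtype _)
    (fun u v => hG.adj _ _) (fun u v => hG.part _ _)
  let g : Y ↪[bipartiteLanguage] Option Y := bipEmbedding Function.Embedding.some
    (fun u v => Iff.rfl) (fun u v => Iff.rfl)
  have := hB.nonempty_embedding T
  obtain ⟨e, he⟩ := hB.ultrahomogeneous.extend_embedding Language.Structure.FG.of_finite f g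
  have hes : ∀ x : Y, e (some x) = x := fun x => (DFunLike.congr_fun he x).symm
  have hadj : ∀ x : Y, G.Adj x (e none) ↔ G.side x ≠ s ∧ p x := by
    intro x
    have h : bipAdj (e (some x)) (e none) ↔ G.side x ≠ s ∧ p x := bipAdj_embedding e _ _
    rwa [hes x, hG.adj] at h
  refine ⟨e none, ?_, ?_, ?_⟩
  · intro h
    have := hes ⟨e none, by simp [Y, h]⟩
    simpa using e.injective this
  · rw [← hb, ← hG.part]
    have h : bipPart (e none) (e (some ⟨b, by simp [Y]⟩)) ↔ s = G.side b :=
      bipPart_embedding e _ _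
    rw [hes] at h
    exact h.2 hb.symm
  · intro x hx hxs
    rw [hadj ⟨x, by simp [Y, hx]⟩]
    exact and_iff_right hxs

end Fraisse

/-! ### A functorial generic graph avoiding the marks. -/

/-- Finite subsets of a countable type can be listed with each one occurring infinitely often, with
indices of either parity. -/
theorem exists_finset_enumeration (K : Type*) [Countable K] :
    ∃ dec : ℕ → Finset K, ∀ F N (b : Bool), ∃ m, N ≤ m ∧ m.bodd = b ∧ dec m = F := by
  obtain ⟨e, he⟩ := exists_surjective_nat (Finset K)
  refine ⟨fun m => e (Nat.unpair m.div2).1, fun F N b => ?_⟩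
  obtain ⟨n, rfl⟩ := he F
  -- The last bit gives the parity, `n` names the set, and `N` only makes the index large.
  refine ⟨Nat.bit b (Nat.pair n N), ?_, Nat.bodd_bit _ _, by simp [Nat.div2_bit]⟩
  have h1 : N ≤ Nat.pair n N := Nat.right_le_pair n N
  have h2 : Nat.pair n N ≤ Nat.bit b (Nat.pair n N) := by
    rw [Nat.bit_val]; omega
  omega

/-- The vertices of the graphs constructed from a set `α`: constants, copies of the elements of
`α`, and copies of the finite sequences in `α`. -/
inductive Vert (α : Type u) : Type u
  | const (i : ℕ) : Vert α
  | base (a : α) (i : ℕ) : Vert α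
  | node (l : List α) (m : ℕ) : Vert α

namespace Vert

variable {α β γ : Type*}

instance [Countable α] : Countable (Vert α) := by
  let f : Vert α → ℕ ⊕ (α × ℕ) ⊕ (List α × ℕ)
    | const i => .inl i
    | base a i => .inr (.inl (a, i))
    | node l m => .inr (.inr (l, m))
  have hf : Function.Injective f := by
    rintro (_ | _ | _) (_ | _ | _) h <;> simp_all [f]
  exact hf.countable

/-- Functoriality of `Vert`. -/
def map (f : α → β) : Vert α → Vert β
  | const i => const i
  | base a i => base (f a) i
  | node l m => node (l.map f) m

theorem map_map (g : β → γ) (f : α → β) (x : Vert α) : map g (map f x) = map (g ∘ f) x := by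
  cases x <;> simp [map]

theorem map_id (x : Vert α) : map id x = x := by
  cases x <;> simp [map]

/-- The elements of `α` used by a vertex. -/
def entries : Vert α → List α
  | const _ => []
  | base a _ => [a]
  | node l _ => l

theorem map_eq_self {f : α → α} {x : Vert α} (h : ∀ a ∈ x.entries, f a = a) : map f x = x := by
  cases x with
  | const i => rfl
  | base a i => simp [map, h a (by simp [entries])]
  | node l m =>
    simp only [map, node.injEq, and_true]
    exact (List.map_congr_left h).trans (List.map_id _)

/-- The second coordinate of a vertex. -/
def index : Vert α → ℕ
  | const i => i
  | base _ i => i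
  | node _ m => m

theorem index_map (f : α → β) (x : Vert α) : (map f x).index = x.index := by
  cases x <;> rfl

/-- The part of a vertex. -/
def side : Vert α → Bool
  | const i => i.bodd
  | base _ i => (i + 1).bodd
  | node _ m => (m + 1).bodd

theorem side_map (f : α → β) (x : Vert α) : (map f x).side = x.side := by
  cases x <;> rfl

/-- An orientation of the marking relation, relative to relations `R i` on `α` which link the
copies of index `i` to those of index `i + 3`. -/
def Arc (R : ℕ → α → α → Prop) : Vert α → Vert α → Prop
  | const i, const j => j = i + 1
  | const i, base _ j => j = i ∨ i = j + 2
  | const i, node _ m => m = i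
  | base a i, base b j => (a = b ∧ j = i + 1) ∨ (R i a b ∧ j = i + 3)
  | node l m, base a i => ∃ k, l[k]? = some a ∧ i = m + 2 * k + 1
  | _, _ => False

/-- The marking relation. -/
def Mark (R : ℕ → α → α → Prop) (x y : Vert α) : Prop := Arc R x y ∨ Arc R y x

variable {R : ℕ → α → α → Prop}

theorem Arc.side_ne {x y : Vert α} (h : Arc R x y) : x.side ≠ y.side := by
  cases x <;> cases y <;> simp only [Arc] at h
  case const.const => subst h; simp [side]
  case const.base => rcases h with rfl | rfl <;> simp [side]
  case const.node => subst h; simp [side]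
  case base.base => rcases h with ⟨-, rfl⟩ | ⟨-, rfl⟩ <;> simp [side]
  case node.base => obtain ⟨k, -, rfl⟩ := h; simp [side]

theorem Mark.symm {x y : Vert α} (h : Mark R x y) : Mark R y x := Or.symm h

theorem Mark.side_ne {x y : Vert α} (h : Mark R x y) : x.side ≠ y.side :=
  h.elim Arc.side_ne fun h => h.side_ne.symm

theorem arc_map {S : ℕ → β → β → Prop} (e : α ≃ β) (h : ∀ i a b, S i (e a) (e b) ↔ R i a b)
    (x y : Vert α) : Arc S (map e x) (map e y) ↔ Arc R x y := by
  cases x <;> cases y <;> simp [map, Arc, h]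

theorem mark_map {S : ℕ → β → β → Prop} (e : α ≃ β) (h : ∀ i a b, S i (e a) (e b) ↔ R i a b)
    (x y : Vert α) : Mark S (map e x) (map e y) ↔ Mark R x y := by
  rw [Mark, Mark, arc_map e h, arc_map e h]

section Coding

variable [Inhabited α] (dec : ℕ → Finset (Vert ℕ))

/-- A node `(l, m)` codes the vertices `k` with numbers replaced by the corresponding terms of
`l`, for `k` in the finite set with index `m`. -/
def Codes : Vert α → Vert α → Prop
  | node l m, x => ∃ k ∈ dec m, map (fun j => l.getD j default) k = x
  | _, _ => False

/-- Coding commutes with relabelling. The default must be fixed because positions beyond the end of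
a list are read as `default`. -/
theorem codes_map (e : α ≃ α) (he : e default = default) (x y : Vert α) :
    Codes dec (map e x) (map e y) ↔ Codes dec x y := by
  have hinj : Function.Injective (map e) := by
    intro x y h
    have := congrArg (map e.symm) h
    simpa [map_map, map_id] using this
  cases x with
  | const i => rfl
  | base a i => rfl
  | node l m =>
    change (∃ k ∈ dec m, map (fun j => (l.map e).getD j default) k = map e y) ↔
      ∃ k ∈ dec m, map (fun j => l.getD j default) k = y
    refine exists_congr fun k => and_congr_right fun _ => ?_
    have : (fun j => (l.map e).getD j default) = e ∘ fun j => l.getD j default := by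
      funext j
      simp only [List.getD_eq_getElem?_getD, List.getElem?_map, Function.comp]
      cases l[j]? <;> simp [he]
    rw [this, ← map_map, hinj.eq_iff]

variable (R)

/-- The generic graph disjoint from the marking relation. -/
def codeGraph : SidedGraph (Vert α) where
  side := side
  Adj x y := x.side ≠ y.side ∧ ¬ Mark R x y ∧ (Codes dec x y ∨ Codes dec y x)
  symm _ _ h := ⟨h.1.symm, fun h' => h.2.1 h'.symm, h.2.2.symm⟩
  side_ne _ _ h := h.1

/-- The union of the generic graph and the marking relation. -/
def unionGraph : SidedGraph (Vert α) where
  side := side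
  Adj x y := (codeGraph R dec).Adj x y ∨ Mark R x y
  symm _ _ h := h.imp ((codeGraph R dec).symm _ _) Mark.symm
  side_ne _ _ h := h.elim ((codeGraph R dec).side_ne _ _) Mark.side_ne

variable {R dec}

theorem codeGraph_adj_map {S : ℕ → α → α → Prop} (e : α ≃ α) (he : e default = default)
    (h : ∀ i a b, S i (e a) (e b) ↔ R i a b) (x y : Vert α) :
    (codeGraph S dec).Adj (map e x) (map e y) ↔ (codeGraph R dec).Adj x y := by
  simp only [codeGraph, side_map, mark_map e h, codes_map dec e he]

theorem codeGraph_generic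
    (hdec : ∀ F N (b : Bool), ∃ m, N ≤ m ∧ m.bodd = b ∧ dec m = F) :
    (codeGraph R dec).Generic := by
  classical
  intro s X p
  -- This list contains every element of `α` used in `X`, so each vertex of `X` is described by
  -- positions in it.
  let l : List α := X.toList.flatMap entries
  have hl : ∀ x ∈ X, map (fun j => l.getD j default) (map (fun a => l.idxOf a) x) = x := by
    intro x hx
    rw [map_map]
    refine map_eq_self fun a ha => ?_
    have hal : a ∈ l := List.mem_flatMap.2 ⟨x, by simpa using hx, ha⟩
    have := List.idxOf_lt_length_iff.2 hal
    simp [List.getD_eq_getElem?_getD, List.getElem?_eq_getElem this]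
  -- A node of index at least `N` is outside `X`, coded by no vertex of `X`, and marked with none.
  let N := X.sup fun x => x.index + 1 + (dec x.index).sup index
  have hN : ∀ x ∈ X, x.index < N ∧ ∀ k ∈ dec x.index, k.index < N := by
    intro x hx
    have h1 : x.index + 1 + (dec x.index).sup index ≤ N :=
      Finset.le_sup (f := fun x : Vert α => x.index + 1 + (dec x.index).sup index) hx
    refine ⟨by omega, fun k hk => ?_⟩
    have : k.index ≤ (dec x.index).sup index := Finset.le_sup hk
    omega
  obtain ⟨m, hm, hms, hdm⟩ := hdec ((X.filter p).image (map fun a => l.idxOf a)) N (!s)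
  refine ⟨node l m, ?_, by simp [codeGraph, side, hms], ?_⟩
  · intro h
    have := (hN _ h).1
    simp only [index] at this
    omega
  intro x hx hxs
  have hcode : Codes dec (node l m) x ↔ p x := by
    simp only [Codes, hdm, Finset.mem_image, Finset.mem_filter]
    constructor
    · rintro ⟨_, ⟨y, ⟨hy, hpy⟩, rfl⟩, rfl⟩
      rwa [hl y hy]
    · intro h
      exact ⟨_, ⟨x, ⟨hx, h⟩, rfl⟩, hl x hx⟩
  have hcode' : ¬ Codes dec x (node l m) := by
    cases x with
    | const i => exact id
    | base a i => exact id
    | node l' m' =>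
      rintro ⟨k, hk, hkm⟩
      have h1 := (hN _ hx).2 k hk
      have h2 : k.index = m := (index_map _ k).symm.trans (congrArg index hkm)
      omega
  have hmark : ¬ Mark R x (node l m) := by
    have h1 := (hN x hx).1
    rintro (h | h)
    · cases x <;> simp only [Arc, index] at h h1
      omega
    · cases x <;> simp only [Arc, index] at h h1
      obtain ⟨k, -, h⟩ := h
      omega
  have hside : x.side ≠ (node l m : Vert α).side := by
    change x.side ≠ (m + 1).bodd
    rwa [Nat.bodd_succ, hms, Bool.not_not]
  simp only [codeGraph, hcode]
  tauto

end Coding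

end Vert

/-! ### Rigidity of the marking relation. -/

theorem Nat.eq_self_of_path_automorphism (π : ℕ ≃ ℕ)
    (h : ∀ i j, (π j = π i + 1 ∨ π i = π j + 1) ↔ (j = i + 1 ∨ i = j + 1)) (i : ℕ) : π i = i := by
  have h0 : π 0 = 0 := by
    by_contra h0
    obtain ⟨k, hk⟩ := Nat.exists_eq_succ_of_ne_zero h0
    -- If 0 went to an interior point of the ray, the preimages of both neighbours would be adjacent
    -- to 0, whose only neighbour is 1.
    have h1 := (h 0 (π.symm k)).1 (by simp [hk])
    have h2 := (h 0 (π.symm (k + 2))).1 (by simp [hk])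
    have h3 : π.symm k = π.symm (k + 2) := by omega
    have := π.symm.injective h3
    omega
  induction i using Nat.strong_induction_on with
  | _ i ih =>
    rcases i with _ | i
    · exact h0
    have h1 := (h i (i + 1)).2 (Or.inl rfl)
    have h2 := ih i (by omega)
    rcases i with _ | i
    · omega
    have h3 := ih i (by omega)
    have h4 : π (i + 1 + 1) ≠ π i := fun h => by
      have := π.injective h
      omega
    omega

namespace Vert

variable {α β : Type*} {R : ℕ → α → α → Prop} {S : ℕ → β → β → Prop}

theorem mark_const_const {i j : ℕ} : Mark R (const i) (const j) ↔ j = i + 1 ∨ i = j + 1 := Iff.rfl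

theorem mark_base_const {a : α} {i j : ℕ} : Mark R (base a i) (const j) ↔ i = j ∨ j = i + 2 := by
  simp [Mark, Arc]

theorem mark_node_const {l : List α} {m j : ℕ} : Mark R (node l m) (const j) ↔ m = j := by
  simp [Mark, Arc]

theorem mark_base_base_succ {a b : α} {i : ℕ} : Mark R (base a i) (base b (i + 1)) ↔ a = b := by
  simp only [Mark, Arc]
  constructor
  · rintro ((⟨h, -⟩ | ⟨-, h⟩) | (⟨-, h⟩ | ⟨-, h⟩))
    · exact h
    all_goals omega
  · exact fun h => Or.inl (Or.inl ⟨h, trivial⟩)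

theorem mark_base_base_add_three {a b : α} {i : ℕ} :
    Mark R (base a i) (base b (i + 3)) ↔ R i a b := by
  simp only [Mark, Arc]
  constructor
  · rintro ((⟨-, h⟩ | ⟨h, -⟩) | (⟨-, h⟩ | ⟨-, h⟩))
    · omega
    · exact h
    all_goals omega
  · exact fun h => Or.inl (Or.inr ⟨h, trivial⟩)

theorem mark_node_base {l : List α} {m k : ℕ} {a : α} :
    Mark R (node l m) (base a (m + 2 * k + 1)) ↔ l[k]? = some a := by
  simp only [Mark, Arc, or_false]
  constructor
  · rintro ⟨k', h, hk⟩
    have : k' = k := by omega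
    rwa [← this]
  · exact fun h => ⟨k, h, rfl⟩

/-- Constants are recognized as the neighbours of leaves: `node [] i` is a leaf at `const i`, and
every vertex has a constant among its neighbours. -/
theorem exists_eq_const_iff {x : Vert α} :
    (∃ i, x = const i) ↔ ∃ p, ∀ z, Mark R p z ↔ z = x := by
  constructor
  · rintro ⟨i, rfl⟩
    refine ⟨node [] i, fun z => ?_⟩
    cases z <;> simp [Mark, Arc, eq_comm]
  · rintro ⟨p, hp⟩
    cases p with
    | const i =>
      have h1 := (hp (const (i + 1))).1 (mark_const_const.2 (Or.inl rfl))
      exact ⟨_, h1.symm⟩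
    | base a i =>
      have h1 := (hp (const i)).1 (mark_base_const.2 (Or.inl rfl))
      exact ⟨_, h1.symm⟩
    | node l m =>
      have h1 := (hp (const m)).1 (mark_node_const.2 rfl)
      exact ⟨_, h1.symm⟩

section Rigid

variable {θ : Vert α ≃ Vert β}

theorem mark_symm_of_mark (h : ∀ x y, Mark S (θ x) (θ y) ↔ Mark R x y) (x y : Vert β) :
    Mark R (θ.symm x) (θ.symm y) ↔ Mark S x y := by
  rw [← h, θ.apply_symm_apply, θ.apply_symm_apply]

theorem exists_apply_const (h : ∀ x y, Mark S (θ x) (θ y) ↔ Mark R x y) (i : ℕ) :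
    ∃ j, θ (const i) = const j := by
  obtain ⟨p, hp⟩ := (exists_eq_const_iff (R := R)).1 ⟨i, rfl⟩
  refine (exists_eq_const_iff (R := S)).2 ⟨θ p, fun z => ?_⟩
  obtain ⟨z, rfl⟩ := θ.surjective z
  rw [h, hp, θ.injective.eq_iff]

theorem apply_const (h : ∀ x y, Mark S (θ x) (θ y) ↔ Mark R x y) (i : ℕ) :
    θ (const i) = const i := by
  choose π hπ using exists_apply_const h
  choose ρ hρ using exists_apply_const (mark_symm_of_mark h)
  let e : ℕ ≃ ℕ := ⟨π, ρ, fun i => by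
      have := hρ (π i)
      rw [← hπ, θ.symm_apply_apply] at this
      exact (const.inj this).symm, fun i => by
      have := hπ (ρ i)
      rw [← hρ, θ.apply_symm_apply] at this
      exact (const.inj this).symm⟩
  rw [hπ]
  refine congrArg const (Nat.eq_self_of_path_automorphism e (fun i j => ?_) i)
  have := h (const i) (const j)
  rwa [hπ, hπ, mark_const_const, mark_const_const] at this

/-- The constants are fixed, and the two marked with a base vertex determine its index; a node is
marked with only one. -/
theorem exists_apply_base (h : ∀ x y, Mark S (θ x) (θ y) ↔ Mark R x y) (a : α) (i : ℕ) :
    ∃ b, θ (base a i) = base b i := by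
  have h1 := (h (base a i) (const i)).2 (mark_base_const.2 (Or.inl rfl))
  have h2 := (h (base a i) (const (i + 2))).2 (mark_base_const.2 (Or.inr rfl))
  rw [apply_const h] at h1 h2
  cases hx : θ (base a i) with
  | const j =>
    rw [← apply_const h, θ.injective.eq_iff] at hx
    cases hx
  | base b j =>
    rw [hx, mark_base_const] at h1 h2
    have : j = i := by omega
    exact ⟨b, by rw [this]⟩
  | node l m =>
    rw [hx, mark_node_const] at h1 h2
    omega

theorem exists_apply_node (h : ∀ x y, Mark S (θ x) (θ y) ↔ Mark R x y) (l : List α) (m : ℕ) :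
    ∃ l', θ (node l m) = node l' m := by
  have h1 := (h (node l m) (const m)).2 (mark_node_const.2 rfl)
  rw [apply_const h] at h1
  cases hx : θ (node l m) with
  | const j =>
    rw [← apply_const h, θ.injective.eq_iff] at hx
    cases hx
  | base b j =>
    obtain ⟨a, ha⟩ := exists_apply_base (mark_symm_of_mark h) b j
    rw [← hx, θ.symm_apply_apply] at ha
    cases ha
  | node l' m' =>
    rw [hx, mark_node_const] at h1
    exact ⟨l', by rw [h1]⟩

theorem exists_forall_apply_base (h : ∀ x y, Mark S (θ x) (θ y) ↔ Mark R x y) :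
    ∃ τ : α → β, ∀ a i, θ (base a i) = base (τ a) i := by
  choose τ hτ using exists_apply_base h
  have hstep : ∀ a i, τ a (i + 1) = τ a i := by
    intro a i
    have := (h (base a i) (base a (i + 1))).2 (mark_base_base_succ.2 rfl)
    rw [hτ, hτ, mark_base_base_succ] at this
    exact this.symm
  refine ⟨fun a => τ a 0, fun a i => ?_⟩
  rw [hτ]
  congr 1
  induction i with
  | zero => rfl
  | succ i ih => rw [hstep, ih]

/-- Every isomorphism of marking relations comes from an isomorphism of the relations from which
they are constructed. -/
theorem exists_equiv_of_mark (h : ∀ x y, Mark S (θ x) (θ y) ↔ Mark R x y) :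
    ∃ e : α ≃ β, (∀ i a b, S i (e a) (e b) ↔ R i a b) ∧ ∀ x, θ x = map e x := by
  obtain ⟨τ, hτ⟩ := exists_forall_apply_base h
  obtain ⟨τ', hτ'⟩ := exists_forall_apply_base (mark_symm_of_mark h)
  have hl : ∀ a, τ' (τ a) = a := by
    intro a
    have := hτ' (τ a) 0
    rw [← hτ, θ.symm_apply_apply] at this
    exact (base.inj this).1.symm
  have hr : ∀ b, τ (τ' b) = b := by
    intro b
    have := hτ (τ' b) 0
    rw [← hτ', θ.apply_symm_apply] at this
    exact (base.inj this).1.symm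
  refine ⟨⟨τ, τ', hl, hr⟩, fun i a b => ?_, fun x => ?_⟩
  · have := h (base a i) (base b (i + 3))
    rwa [hτ, hτ, mark_base_base_add_three, mark_base_base_add_three] at this
  · cases x with
    | const i => exact apply_const h i
    | base a i => exact hτ a i
    | node l m =>
      obtain ⟨l', hl'⟩ := exists_apply_node h l m
      rw [hl']
      -- The list is recovered entry by entry: position `k` is the base vertex marked at index `m +
      -- 2 * k + 1`.
      refine congrArg (node · m) (List.ext_getElem? fun k => Option.ext fun b => ?_)
      have := h (node l m) (base (τ' b) (m + 2 * k + 1))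
      rw [hl', hτ, mark_node_base, mark_node_base, hr] at this
      rw [this]
      simp only [Equiv.coe_fn_mk, List.getElem?_map, Option.map_eq_some_iff]
      constructor
      · exact fun h => ⟨_, h, hr b⟩
      · rintro ⟨a, ha, rfl⟩
        rwa [hl]

end Rigid

/-! ### Encoding a graph and a set of natural numbers. -/

section Chord

variable {W : Type*} (Γ : SimpleGraph W) (A : Set ℕ)

/-- The relations on `Option W` that encode a graph on `W` and a set of natural numbers. -/
def Chord : ℕ → Option W → Option W → Prop
  | 0, some a, some b => Γ.Adj a b
  | 1, none, none => True
  | i + 2, none, none => i ∈ A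
  | _, _, _ => False

variable {Γ A}

theorem chord_optionCongr (σ : Γ ≃g Γ) (i : ℕ) (a b : Option W) :
    Chord Γ A i (Equiv.optionCongr σ.toEquiv a) (Equiv.optionCongr σ.toEquiv b) ↔
      Chord Γ A i a b := by
  rcases i with _ | _ | i <;> rcases a with _ | a <;> rcases b with _ | b <;>
    first | exact Iff.rfl | exact σ.map_adj_iff

/-- The loop at level 1 singles out `none`; the loops at higher levels then spell out the set, and
level 0 is the graph on the remaining points. -/
theorem exists_of_chord {A' : Set ℕ} {e : Option W ≃ Option W}
    (h : ∀ i a b, Chord Γ A' i (e a) (e b) ↔ Chord Γ A i a b) :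
    A' = A ∧ ∃ σ : Γ ≃g Γ, e = Equiv.optionCongr σ.toEquiv := by
  have he : e none = none := by
    have := (h 1 none none).2 trivial
    cases hx : e none with
    | none => rfl
    | some a =>
      rw [hx] at this
      exact this.elim
  refine ⟨?_, ?_⟩
  · ext i
    have := h (i + 2) none none
    rw [he] at this
    exact this
  · have hs : ∀ a, some (Equiv.removeNone e a) = e (some a) := by
      intro a
      refine Equiv.removeNone_some e ?_
      cases hx : e (some a) with
      | none => cases e.injective (hx.trans he.symm)
      | some b => exact ⟨b, rfl⟩
    refine ⟨⟨Equiv.removeNone e, fun {a b} => ?_⟩, ?_⟩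
    · have := h 0 (some a) (some b)
      rw [← hs, ← hs] at this
      exact this
    · ext1 x
      cases x with
      | none => exact he
      | some a => exact (hs a).symm

end Chord

end Vert

/-! ### Retracts of `B` and the endomorphisms built from them. -/

namespace SidedGraph

variable {V : Type*}

/-- A graph that projects onto `F`, with a section on `V × {0}`, and with the other edges selected
by an enumeration of finite sets. -/
def blowup (F : SidedGraph V) (dec : ℕ → Finset (V × ℕ)) : SidedGraph (V × ℕ) where
  side x := F.side x.1
  Adj x y := F.Adj x.1 y.1 ∧ ((x.2 = 0 ∧ y.2 = 0) ∨ x ∈ dec y.2 ∨ y ∈ dec x.2)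
  symm _ _ h := ⟨F.symm _ _ h.1, h.2.imp And.symm Or.symm⟩
  side_ne _ _ h := F.side_ne _ _ h.1

theorem blowup_generic {F : SidedGraph V} {dec : ℕ → Finset (V × ℕ)}
    (hF : ∀ (s : Bool) (X : Finset V), ∃ v, F.side v = s ∧ ∀ x ∈ X, F.side x ≠ s → F.Adj x v)
    (hdec : ∀ S N (b : Bool), ∃ m, N ≤ m ∧ m.bodd = b ∧ dec m = S) : (F.blowup dec).Generic := by
  classical
  intro s X p
  obtain ⟨v, hv, hadj⟩ := hF s (X.image Prod.fst)
  let N := X.sup fun x => x.2 + 1 + (dec x.2).sup Prod.snd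
  have hN : ∀ x ∈ X, x.2 < N ∧ ∀ k ∈ dec x.2, k.2 < N := by
    intro x hx
    have h1 : x.2 + 1 + (dec x.2).sup Prod.snd ≤ N :=
      Finset.le_sup (f := fun x : V × ℕ => x.2 + 1 + (dec x.2).sup Prod.snd) hx
    refine ⟨by omega, fun k hk => ?_⟩
    have : k.2 ≤ (dec x.2).sup Prod.snd := Finset.le_sup hk
    omega
  -- The parity is irrelevant here, as the side comes from `v`. Above the common neighbour `v`, the
  -- index `m` selects exactly the desired edges.
  obtain ⟨m, hm, -, hdm⟩ := hdec (X.filter p) N true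
  refine ⟨(v, m), fun h => absurd (hN _ h).1 (by simpa using hm), hv, fun x hx hxs => ?_⟩
  have h1 : (v, m) ∉ dec x.2 := fun h => absurd ((hN x hx).2 _ h) (by simpa using hm)
  have h2 := (hN x hx).1
  have h3 : ¬ (x.2 = 0 ∧ m = 0) := by omega
  have h4 : F.Adj x.1 v := hadj _ (Finset.mem_image_of_mem _ hx) hxs
  simp only [blowup, hdm, h4, h1, h3, Finset.mem_filter, hx, true_and, false_or, or_false]

end SidedGraph

section Apply

variable {L : Language} {A : Type*} [L.Structure A]

/-- The underlying map of an endomorphism. -/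
def StructureEnd.apply (f : StructureEnd L A) : A → A := Language.Hom.toFun f

theorem StructureEnd.apply_injective :
    Function.Injective (StructureEnd.apply : StructureEnd L A → A → A) := by
  intro f g h
  exact Language.Hom.ext (congrFun h)

theorem StructureEnd.mul_apply (f g : StructureEnd L A) (x : A) :
    (f * g).apply x = g.apply (f.apply x) := rfl

theorem StructureEnd.adj {B : Type*} [bipartiteLanguage.Structure B] {G : SidedGraph B}
    (hG : G.Describes) (f : StructureEnd bipartiteLanguage B) {u v : B} (h : G.Adj u v) :
    G.Adj (f.apply u) (f.apply v) := by
  rw [← hG.adj] at h ⊢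
  exact bipAdj_hom (show B →[bipartiteLanguage] B from f) h

end Apply

/-- Data for an endomorphism of `G` that is an isomorphism from `G` to `E`, followed by the
inclusion of `E` in a larger graph `F` on the same vertices and a section `ι` of a
retraction `ρ` from `G` to `F`. -/
structure Realization {B V : Type*} (G : SidedGraph B) (E F : SidedGraph V) where
  /-- The isomorphism from `G` to `E`. -/
  β : B ≃ V
  /-- The section. -/
  ι : V → B
  /-- The retraction. -/
  ρ : B → V
  side_eq : ∀ v, E.side v = F.side v
  adj_of_adj : ∀ u v, E.Adj u v → F.Adj u v
  side_β : ∀ b, E.side (β b) = G.side b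
  adj_β : ∀ a b, E.Adj (β a) (β b) ↔ G.Adj a b
  side_ι : ∀ v, G.side (ι v) = F.side v
  adj_ι : ∀ u v, G.Adj (ι u) (ι v) ↔ F.Adj u v
  ρ_ι : ∀ v, ρ (ι v) = v
  side_ρ : ∀ b, F.side (ρ b) = G.side b
  adj_ρ : ∀ a b, G.Adj a b → F.Adj (ρ a) (ρ b)

theorem exists_realization {B V : Type*} [Countable B] [Countable V] {G : SidedGraph B}
    (hG : G.Generic) {E F : SidedGraph V} (hE : E.Generic) (hs : ∀ v, E.side v = F.side v)
    (hEF : ∀ u v, E.Adj u v → F.Adj u v) : Nonempty (Realization G E F) := by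
  obtain ⟨dec, hdec⟩ := exists_finset_enumeration (V × ℕ)
  obtain ⟨β, hβ, hβ'⟩ := hG.exists_equiv hE
  have hF : ∀ (s : Bool) (X : Finset V),
      ∃ v, F.side v = s ∧ ∀ x ∈ X, F.side x ≠ s → F.Adj x v := by
    intro s X
    obtain ⟨v, -, hv, h⟩ := hE s X fun _ => True
    exact ⟨v, by rw [← hs, hv], fun x hx hxs => hEF _ _ ((h x hx (by rwa [hs])).2 trivial)⟩
  obtain ⟨γ, hγ, hγ'⟩ := hG.exists_equiv (SidedGraph.blowup_generic hF hdec)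
  refine ⟨⟨β, fun v => γ.symm (v, 0), fun b => (γ b).1, hs, hEF, hβ, hβ', fun v => ?_,
    fun u v => ?_, fun v => by simp, hγ, fun a b h => ((hγ' a b).2 h).1⟩⟩
  · rw [← hγ, γ.apply_symm_apply]
    rfl
  · rw [← hγ', γ.apply_symm_apply, γ.apply_symm_apply]
    simp [SidedGraph.blowup]

theorem Realization.ι_injective {B V : Type*} {G : SidedGraph B} {E F : SidedGraph V}
    (r : Realization G E F) : Function.Injective r.ι :=
  Function.LeftInverse.injective r.ρ_ι

namespace Realization

variable {B V V' : Type*} [bipartiteLanguage.Structure B] {G : SidedGraph B} {E F : SidedGraph V}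
  {E' F' : SidedGraph V'}

/-- The endomorphism given by a realization. -/
def toEnd (hG : G.Describes) (r : Realization G E F) : StructureEnd bipartiteLanguage B :=
  bipHom (fun b => r.ι (r.β b))
    (fun u v h => by
      rw [hG.adj] at h ⊢
      exact (r.adj_ι _ _).2 (r.adj_of_adj _ _ ((r.adj_β _ _).2 h)))
    (fun u v h => by
      rw [hG.part] at h ⊢
      rw [r.side_ι, r.side_ι, ← r.side_eq, ← r.side_eq, r.side_β, r.side_β, h])

variable (hG : G.Describes)

theorem toEnd_apply (r : Realization G E F) (b : B) : (r.toEnd hG).apply b = r.ι (r.β b) := rfl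

/-- The left factors `n`, `m` give mutually inverse maps preserving the smaller graphs. On the
images of the sections the right factors `p`, `q` induce the same two maps, which therefore preserve
the larger graphs too. -/
theorem exists_equiv_of_factorizations (r : Realization G E F) (r' : Realization G E' F')
    {c m n p q : StructureEnd bipartiteLanguage B} (h₁ : c = m * r.toEnd hG)
    (h₂ : r.toEnd hG = n * c) (h₃ : r'.toEnd hG = c * p) (h₄ : c = r'.toEnd hG * q) :
    ∃ θ : V ≃ V', (∀ u v, E'.Adj (θ u) (θ v) ↔ E.Adj u v) ∧
      (∀ u v, F'.Adj (θ u) (θ v) ↔ F.Adj u v) ∧ ∀ v, q.apply (r'.ι v) = r.ι (θ.symm v) := by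
  have e₁ : ∀ b, c.apply b = r.ι (r.β (m.apply b)) := fun b =>
    congrArg (fun f => StructureEnd.apply f b) h₁
  have e₂ : ∀ b, r.ι (r.β b) = c.apply (n.apply b) := fun b =>
    congrArg (fun f => StructureEnd.apply f b) h₂
  have e₃ : ∀ b, r'.ι (r'.β b) = p.apply (c.apply b) := fun b =>
    congrArg (fun f => StructureEnd.apply f b) h₃
  have e₄ : ∀ b, c.apply b = q.apply (r'.ι (r'.β b)) := fun b =>
    congrArg (fun f => StructureEnd.apply f b) h₄
  let φ : V → V' := fun v => r'.β (n.apply (r.β.symm v))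
  let ψ : V' → V := fun v => r.β (m.apply (r'.β.symm v))
  have hp : ∀ v, p.apply (r.ι v) = r'.ι (φ v) := fun v => by
    have := e₂ (r.β.symm v)
    rw [r.β.apply_symm_apply] at this
    rw [this, ← e₃]
  have hq : ∀ v, q.apply (r'.ι v) = r.ι (ψ v) := fun v => by
    rw [← e₁, e₄, r'.β.apply_symm_apply]
  have hψφ : ∀ v, ψ (φ v) = v := fun v => by
    apply r.ι_injective
    rw [← hq, ← e₄, ← e₂, r.β.apply_symm_apply]
  have hφψ : ∀ v, φ (ψ v) = v := fun v => by
    apply r'.ι_injective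
    rw [← hp, ← e₁, ← e₃, r'.β.apply_symm_apply]
  have hE : ∀ u v, E.Adj u v → E'.Adj (φ u) (φ v) := fun u v h => by
    rw [r'.adj_β]
    refine n.adj hG ?_
    rwa [← r.adj_β, r.β.apply_symm_apply, r.β.apply_symm_apply]
  have hE' : ∀ u v, E'.Adj u v → E.Adj (ψ u) (ψ v) := fun u v h => by
    rw [r.adj_β]
    refine m.adj hG ?_
    rwa [← r'.adj_β, r'.β.apply_symm_apply, r'.β.apply_symm_apply]
  have hF : ∀ u v, F.Adj u v → F'.Adj (φ u) (φ v) := fun u v h => by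
    rw [← r'.adj_ι, ← hp, ← hp]
    exact p.adj hG ((r.adj_ι _ _).2 h)
  have hF' : ∀ u v, F'.Adj u v → F.Adj (ψ u) (ψ v) := fun u v h => by
    rw [← r.adj_ι, ← hq, ← hq]
    exact q.adj hG ((r'.adj_ι _ _).2 h)
  refine ⟨⟨φ, ψ, hψφ, hφψ⟩, fun u v => ⟨fun h => ?_, hE u v⟩, fun u v => ⟨fun h => ?_, hF u v⟩, hq⟩
  · have := hE' _ _ h
    rwa [Equiv.coe_fn_mk, hψφ, hψφ] at this
  · have := hF' _ _ h
    rwa [Equiv.coe_fn_mk, hψφ, hψφ] at this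

theorem exists_equiv_of_greenD (r : Realization G E F) (r' : Realization G E' F')
    (h : GreenD (r.toEnd hG) (r'.toEnd hG)) :
    ∃ θ : V ≃ V', (∀ u v, E'.Adj (θ u) (θ v) ↔ E.Adj u v) ∧
      ∀ u v, F'.Adj (θ u) (θ v) ↔ F.Adj u v := by
  obtain ⟨c, hL, hR⟩ := h
  obtain ⟨m, n, h₁, h₂⟩ := greenL_iff.1 hL
  obtain ⟨p, q, h₃, h₄⟩ := greenR_iff.1 hR
  obtain ⟨θ, hE, hF, -⟩ := r.exists_equiv_of_factorizations hG r' h₁ h₂ h₃ h₄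
  exact ⟨θ, hE, hF⟩

theorem exists_equiv_of_greenH (r : Realization G E F) {t : StructureEnd bipartiteLanguage B}
    (h : GreenH (r.toEnd hG) (r.toEnd hG * t)) :
    ∃ θ : V ≃ V, (∀ u v, E.Adj (θ u) (θ v) ↔ E.Adj u v) ∧
      (∀ u v, F.Adj (θ u) (θ v) ↔ F.Adj u v) ∧ ∀ v, t.apply (r.ι v) = r.ι (θ.symm v) := by
  obtain ⟨m, n, h₁, h₂⟩ := greenL_iff.1 h.1
  obtain ⟨-, p, -, h₃⟩ := greenR_iff.1 h.2
  exact r.exists_equiv_of_factorizations hG r h₁ h₂ h₃ rfl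

theorem exists_greenH (r : Realization G E F) (θ : V ≃ V)
    (hE : ∀ u v, E.Adj (θ u) (θ v) ↔ E.Adj u v) (hF : ∀ u v, F.Adj (θ u) (θ v) ↔ F.Adj u v)
    (hs : ∀ v, F.side (θ v) = F.side v) :
    ∃ t : StructureEnd bipartiteLanguage B, GreenH (r.toEnd hG) (r.toEnd hG * t) ∧
      ∀ v, t.apply (r.ι v) = r.ι (θ v) := by
  have key : ∀ θ : V ≃ V, (∀ u v, E.Adj (θ u) (θ v) ↔ E.Adj u v) →
      (∀ u v, F.Adj (θ u) (θ v) ↔ F.Adj u v) → (∀ v, F.side (θ v) = F.side v) →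
      ∃ t u : StructureEnd bipartiteLanguage B, (∀ v, t.apply (r.ι v) = r.ι (θ v)) ∧
        ∀ b, u.apply b = r.β.symm (θ (r.β b)) := by
    intro θ hE hF hs
    -- Right multiplication needs an endomorphism of all of `B` extending `θ` on the copy of `F`,
    -- which the retraction supplies; left multiplication conjugates `θ` by `β`.
    refine ⟨bipHom (fun b => r.ι (θ (r.ρ b))) (fun a b h => ?_) (fun a b h => ?_),
      bipHom (fun b => r.β.symm (θ (r.β b))) (fun a b h => ?_) (fun a b h => ?_),
      fun v => ?_, fun b => rfl⟩
    · rw [hG.adj] at h ⊢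
      rw [r.adj_ι, hF]
      exact r.adj_ρ _ _ h
    · rw [hG.part] at h ⊢
      rw [r.side_ι, r.side_ι, hs, hs, r.side_ρ, r.side_ρ, h]
    · rw [hG.adj] at h ⊢
      rwa [← r.adj_β, r.β.apply_symm_apply, r.β.apply_symm_apply, hE, r.adj_β]
    · rw [hG.part] at h ⊢
      rw [← r.side_β, ← r.side_β, r.β.apply_symm_apply, r.β.apply_symm_apply, r.side_eq,
        r.side_eq, hs, hs, ← r.side_eq, ← r.side_eq, r.side_β, r.side_β, h]
    · change r.ι (θ (r.ρ (r.ι v))) = _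
      rw [r.ρ_ι]
  obtain ⟨t, u, ht, hu⟩ := key θ hE hF hs
  obtain ⟨t', u', ht', hu'⟩ := key θ.symm
    (fun a b => by rw [← hE, θ.apply_symm_apply, θ.apply_symm_apply])
    (fun a b => by rw [← hF, θ.apply_symm_apply, θ.apply_symm_apply])
    (fun a => by rw [← hs, θ.apply_symm_apply])
  have e : r.toEnd hG * t = u * r.toEnd hG := StructureEnd.apply_injective <| funext fun b => by
    rw [StructureEnd.mul_apply, StructureEnd.mul_apply, toEnd_apply, toEnd_apply, ht, hu,
      r.β.apply_symm_apply]
  refine ⟨t, ⟨greenL_iff.2 ⟨u, u', e, ?_⟩, greenR_iff.2 ⟨t, t', rfl, ?_⟩⟩, ht⟩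
  · refine StructureEnd.apply_injective <| funext fun b => ?_
    rw [StructureEnd.mul_apply, StructureEnd.mul_apply, hu', toEnd_apply, toEnd_apply, ht,
      r.β.apply_symm_apply, θ.apply_symm_apply]
  · refine StructureEnd.apply_injective <| funext fun b => ?_
    rw [StructureEnd.mul_apply, StructureEnd.mul_apply, toEnd_apply, ht, ht', θ.symm_apply_apply]

theorem not_isRegularElement (r : Realization G E F) {u v : V} (hE : ¬ E.Adj u v)
    (hF : F.Adj u v) : ¬ IsRegularElement (r.toEnd hG) := by
  rintro ⟨g, hg⟩
  -- The endomorphism is injective, so `g` undoes it and would send the extra edge of `F` to an edge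
  -- of `E`.
  have h : ∀ b, g.apply (r.ι (r.β b)) = b := fun b =>
    r.β.injective (r.ι_injective (congrArg (fun f => StructureEnd.apply f b) hg))
  have hg' := g.adj hG ((r.adj_ι _ _).2 hF)
  rw [← r.β.apply_symm_apply u, ← r.β.apply_symm_apply v, h, h, ← r.adj_β,
    r.β.apply_symm_apply, r.β.apply_symm_apply] at hg'
  exact hE hg'

end Realization

/-! ### The Schützenberger groups and the count of 𝓓-classes. -/

section Main

open Vert

variable {B : Type*} [bipartiteLanguage.Structure B] {G : SidedGraph B} (hG : G.Describes)
  {W : Type*} {Γ : SimpleGraph W} {A A' : Set ℕ} {dec : ℕ → Finset (Vert ℕ)}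

/-- The realizations of the graphs that encode `Γ` and `A`. -/
abbrev ChordRealization (G : SidedGraph B) (Γ : SimpleGraph W) (dec : ℕ → Finset (Vert ℕ))
    (A : Set ℕ) : Type _ :=
  Realization G (codeGraph (Chord Γ A) dec) (unionGraph (Chord Γ A) dec)

theorem mark_iff_unionGraph_adj_and_not {α : Type*} [Inhabited α] {R : ℕ → α → α → Prop}
    (x y : Vert α) :
    Mark R x y ↔ (unionGraph R dec).Adj x y ∧ ¬ (codeGraph R dec).Adj x y := by
  refine ⟨fun h => ⟨Or.inr h, fun h' => h'.2.1 h⟩, ?_⟩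
  rintro ⟨h | h, h'⟩
  · exact absurd h h'
  · exact h

theorem mark_iff_of_adj_iff {α β : Type*} [Inhabited α] [Inhabited β] {R : ℕ → α → α → Prop}
    {S : ℕ → β → β → Prop} {θ : Vert α ≃ Vert β}
    (hE : ∀ u v, (codeGraph S dec).Adj (θ u) (θ v) ↔ (codeGraph R dec).Adj u v)
    (hF : ∀ u v, (unionGraph S dec).Adj (θ u) (θ v) ↔ (unionGraph R dec).Adj u v)
    (u v : Vert α) : Mark S (θ u) (θ v) ↔ Mark R u v := by
  rw [mark_iff_unionGraph_adj_and_not (dec := dec), hE, hF, ← mark_iff_unionGraph_adj_and_not]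

/-- The automorphism of `Vert (Option W)` induced by an automorphism of `Γ`. -/
def liftAut (σ : Γ ≃g Γ) : Vert (Option W) ≃ Vert (Option W) where
  toFun := map (Equiv.optionCongr σ.toEquiv)
  invFun := map (Equiv.optionCongr σ.toEquiv).symm
  left_inv x := by simp [map_map, map_id]
  right_inv x := by simp [map_map, map_id]

theorem liftAut_mul (σ τ : Γ ≃g Γ) (x : Vert (Option W)) :
    liftAut (σ * τ) x = liftAut σ (liftAut τ x) := by
  simp only [liftAut, Equiv.coe_fn_mk, map_map]
  congr 1
  funext a
  cases a <;> rfl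

theorem liftAut_inv (σ : Γ ≃g Γ) : liftAut σ⁻¹ = (liftAut σ).symm := rfl

theorem liftAut_injective : Function.Injective (liftAut : (Γ ≃g Γ) → _) := by
  intro σ τ h
  ext w
  have := congrArg (fun f : Vert (Option W) ≃ Vert (Option W) => f (base (some w) 0)) h
  exact Option.some_injective _ (base.inj this).1

theorem ChordRealization.set_eq (r : ChordRealization G Γ dec A) (r' : ChordRealization G Γ dec A')
    (h : GreenD (r.toEnd hG) (r'.toEnd hG)) : A = A' := by
  obtain ⟨θ, hE, hF⟩ := r.exists_equiv_of_greenD hG r' h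
  obtain ⟨e, he, -⟩ := exists_equiv_of_mark (mark_iff_of_adj_iff hE hF)
  exact (exists_of_chord he).1.symm

theorem ChordRealization.not_isRegularElement (r : ChordRealization G Γ dec A) :
    ¬ IsRegularElement (r.toEnd hG) := by
  have h : Mark (Chord Γ A) (const 0) (const 1) := Or.inl rfl
  exact Realization.not_isRegularElement hG r (fun h' => h'.2.1 h) (Or.inr h)

theorem ChordRealization.nonempty_mulEquiv (r : ChordRealization G Γ dec A) :
    Nonempty (schutzenbergerGroup (HClass (r.toEnd hG)) ≃* (Γ ≃g Γ)) := by
  suffices h : Nonempty (MonoidHom.mrange (gammaHom (HClass (r.toEnd hG))) ≃*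
      MonoidHom.mrange (MonoidHom.id (Γ ≃g Γ))) by
    rw [MonoidHom.mrange_id] at h
    exact h.map fun e => e.trans Submonoid.topEquiv
  refine nonempty_mulEquiv_mrange_of_correspondence _ _
    -- The inverse reconciles endomorphisms composed from left to right with automorphisms composed
    -- from right to left.
    (fun t σ => ∀ v, t.1.apply (r.ι v) = r.ι (liftAut σ⁻¹ v)) ?_ ?_ ?_ ?_
  · rintro ⟨t, ht⟩
    obtain ⟨θ, hE, hF, hθ⟩ := r.exists_equiv_of_greenH hG (mem_rightStabilizer_iff.1 ht)
    obtain ⟨e, he, hθe⟩ := exists_equiv_of_mark (mark_iff_of_adj_iff hE hF)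
    obtain ⟨σ, rfl⟩ := (exists_of_chord he).2
    have : θ = liftAut σ := Equiv.ext hθe
    refine ⟨σ, fun v => ?_⟩
    rw [hθ, this, liftAut_inv]
  · intro σ
    have hE := codeGraph_adj_map (dec := dec) (Equiv.optionCongr (σ⁻¹ : Γ ≃g Γ).toEquiv) rfl
      (chord_optionCongr (A := A) σ⁻¹)
    have hM := mark_map _ (chord_optionCongr (A := A) (σ⁻¹ : Γ ≃g Γ))
    obtain ⟨t, ht, h⟩ := r.exists_greenH hG (liftAut σ⁻¹) hE
      (fun u v => or_congr (hE u v) (hM u v)) (fun v => side_map _ v)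
    exact ⟨⟨t, mem_rightStabilizer_iff.2 ht⟩, h⟩
  · intro t t' σ σ' h h' v
    change t'.1.apply (t.1.apply (r.ι v)) = _
    rw [h, h', mul_inv_rev, liftAut_mul]
  · intro t t' σ σ' h h'
    rw [gammaHom_eq_iff, MonoidHom.id_apply, MonoidHom.id_apply]
    constructor
    · intro e
      refine inv_injective (liftAut_injective (Equiv.ext fun v => r.ι_injective ?_))
      have := congrArg (fun f => StructureEnd.apply f (r.β.symm v)) e
      simp only [StructureEnd.mul_apply, Realization.toEnd_apply, Equiv.apply_symm_apply] at this
      rw [← h, ← h', this]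
    · rintro rfl
      refine StructureEnd.apply_injective (funext fun b => ?_)
      rw [StructureEnd.mul_apply, StructureEnd.mul_apply, Realization.toEnd_apply, h, h']

theorem greenD_of_dClass_eq {M : Type*} [Monoid M] {a b : M} (h : DClass a = DClass b) :
    GreenD a b := by
  have : b ∈ DClass b := greenD_refl b
  rwa [← h] at this

theorem StructureEnd.mk_le (L : Language) (C : Type*) [Countable C] [L.Structure C] :
    Cardinal.mk (StructureEnd L C) ≤ 2 ^ Cardinal.aleph0 := by
  refine (Cardinal.mk_le_of_injective StructureEnd.apply_injective).trans ?_
  rw [← Cardinal.power_def]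
  refine (Cardinal.power_le_power_right (Cardinal.mk_le_aleph0 (α := C))).trans ?_
  rcases isEmpty_or_nonempty C with h | h
  · rw [Cardinal.mk_eq_zero, Cardinal.power_zero]
    exact Cardinal.one_le_iff_pos.2 (Cardinal.power_pos _ two_pos)
  · rw [← Cardinal.power_self_eq le_rfl]
    exact Cardinal.power_le_power_left Cardinal.aleph0_ne_zero Cardinal.mk_le_aleph0

end Main

/-- For every countable graph `Γ`, exactly `2 ^ ℵ₀` of the `D`-classes of `End B` are non-regular
and have all their `H`-classes with Schützenberger group isomorphic to `Aut Γ`. -/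
theorem mainTheorem11 {B : Type*} [Countable B] [bipartiteLanguage.Structure B]
    (hB : IsCountableUniversalBipartiteGraph B)
    {W : Type*} [Countable W] (Γ : SimpleGraph W) :
    Cardinal.mk {D : Set (StructureEnd bipartiteLanguage B) //
      (∃ f, D = DClass f) ∧
      (∀ f ∈ D, ¬ IsRegularElement f) ∧
      (∀ f ∈ D, Nonempty (schutzenbergerGroup (HClass f) ≃* (Γ ≃g Γ)))} =
    2 ^ Cardinal.aleph0 := by
  obtain ⟨G, hG⟩ := hB.exists_describes
  have hgen := hG.generic hB
  obtain ⟨dec, hdec⟩ := exists_finset_enumeration (Vert ℕ)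
  have hr : ∀ A : Set ℕ, Nonempty (ChordRealization G Γ dec A) := fun A =>
    exists_realization hgen (Vert.codeGraph_generic hdec) (fun _ => rfl) fun _ _ => Or.inl
  let r := fun A => (hr A).some
  apply le_antisymm
  -- Choosing a representative embeds the set of classes in the monoid.
  · refine le_trans ?_ (StructureEnd.mk_le bipartiteLanguage B)
    choose F hF using fun D : {D : Set (StructureEnd bipartiteLanguage B) //
      (∃ f, D = DClass f) ∧
      (∀ f ∈ D, ¬ IsRegularElement f) ∧
      (∀ f ∈ D, Nonempty (schutzenbergerGroup (HClass f) ≃* (Γ ≃g Γ)))} => D.2.1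
    refine Cardinal.mk_le_of_injective (f := F) fun D D' h => Subtype.ext ?_
    rw [hF D, hF D', h]
  · have h : Cardinal.mk (ULift (Set ℕ)) = 2 ^ Cardinal.aleph0 := by simp
    rw [← h]
    refine Cardinal.mk_le_of_injective
      (f := fun A => ⟨DClass ((r A.down).toEnd hG), ⟨_, rfl⟩, fun f hf hreg => ?_,
        fun f hf => ?_⟩) fun A A' hAA' => ULift.ext _ _ ?_
    · exact (r A.down).not_isRegularElement hG (hreg.of_greenD hf)
    · obtain ⟨e⟩ := GreenD.nonempty_schutzenbergerGroup_mulEquiv hf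
      obtain ⟨e'⟩ := ChordRealization.nonempty_mulEquiv hG (r A.down)
      exact ⟨e.symm.trans e'⟩
    · exact ChordRealization.set_eq hG _ _ (greenD_of_dClass_eq (congrArg Subtype.val hAA'))
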